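/- Let $m,n\ge 0$ be integers, $[m]=\{1,\dots,m\}$, and let $\mathcal B\subseteq\binom{[m]}{n}$ be any family of $n$-element subsets of $[m]$, with dual family $\mathcal B^\star=\{[m]\setminus S: S\in\mathcal B\}$. For a polynomial $p\in\mathbb R[z_1,\dots,z_m]$ and $S\subseteq[m]$ let $p_S$ be the coefficient of $z^S=\prod_{i\in S}z_i$ in $p$, and let $p_{\mathcal B}=\sum_{S\in\mathcal B}p_S$. The polynomial $p$ is *real stable* if $p(z)\neq 0$ for all $z\in\mathbb C^m$ with $\operatorname{Im} z_i>0$ for every $i$, and *multiaffine* if only square-free monomials $z^S$ occur in it. For a family $\mathcal F$ of subsets of $[m]$ let $P(\mathcal F)=\operatorname{conv}\{1_S:S\in\mathcal F\}\subseteq[0,1]^m$, and for $p$ with nonnegative coefficients put $$\mathrm{Cap}_{\mathcal F}(p)=\sup_{\theta\in P(\mathcal F)}\ \inf_{z>0}\frac{p(z)}{\prod_{i=1}^m z_i^{\theta_i}},\qquad \underline{\mathrm{Cap}}_{\mathcal F}(p)=\inf_{\theta\in P(\mathcal F)}\ \inf_{z>0}\frac{p(z)}{\prod_{i=1}^m z_i^{\theta_i}}$$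 (if $\mathcal F=\emptyset$, both are read as $0$; also $0^0=1$). Let $c\ge 1$. A *$c$-approximate $\mathcal B^\star$-selection* is an $(m-n)$-homogeneous polynomial $h\in\mathbb R[z_1,\dots,z_m]$ with nonnegative coefficients such that, for $S\in\binom{[m]}{m-n}$, $h_S>0$ only if $S\in\mathcal B^\star$, and $h_S\in[1,c]$ for every $S\in\mathcal B^\star$. A *$\mathcal B^\star$-selection* is defined in the same way, with $h_S=1$ for every $S\in\mathcal B^\star$. Let $g\in\mathbb R[z_1,\dots,z_m]$ be a real stable, $n$-homogeneous polynomial with nonnegative coefficients. Then the following hold. 1. $g_{\mathcal B}\le \mathrm{Cap}_{\mathcal B}(g)$. 2. For every real stable $\mathcal B^\star$-selection $h$, $$\mathrm{Cap}_{\mathcal B}(g)\cdot\underline{\mathrm{Cap}}_{\mathcal B^\star}(h)\cdot\frac{m!}{m^m}\ \le\ g_{\mathcal B},$$ and if moreover $g$ and $h$ are both multiaffine, then $\mathrm{Cap}_{\mathcal B}(g)\cdot\underline{\mathrm{Cap}}_{\mathcal B^\star}(h)\cdot 2^{-m}\le g_{\mathcal B}$. 3. For every $c\ge1$ and every real stable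 $c$-approximate $\mathcal B^\star$-selection $h$, $$\frac1c\cdot\mathrm{Cap}_{\mathcal B}(g)\cdot\underline{\mathrm{Cap}}_{\mathcal B^\star}(h)\cdot\frac{m!}{m^m}\ \le\ g_{\mathcal B},$$ and if moreover $g$ and $h$ are both multiaffine, then $\frac1c\cdot\mathrm{Cap}_{\mathcal B}(g)\cdot\underline{\mathrm{Cap}}_{\mathcal B^\star}(h)\cdot 2^{-m}\le g_{\mathcal B}$. -/

import Mathlib

namespace SetCapacity

noncomputable section

/-- A real polynomial with nonnegative coefficients. -/
def NonnegCoeffs {m : ℕ} (p : MvPolynomial (Fin m) ℝ) : Prop :=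
  ∀ α : Fin m →₀ ℕ, 0 ≤ p.coeff α

/-- Real stability: no zero in the product of open upper half-planes
(in particular the zero polynomial is not real stable). -/
def IsRealStable {m : ℕ} (p : MvPolynomial (Fin m) ℝ) : Prop :=
  ∀ z : Fin m → ℂ, (∀ i, 0 < (z i).im) → MvPolynomial.aeval z p ≠ 0

/-- Only square-free monomials occur. -/
def IsMultiaffine {m : ℕ} (p : MvPolynomial (Fin m) ℝ) : Prop :=
  ∀ α ∈ p.support, ∀ i, α i ≤ 1

/-- The coefficient `p_S` of the square-free monomial `∏ i ∈ S, z i`. -/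
def setCoeff {m : ℕ} (p : MvPolynomial (Fin m) ℝ) (S : Finset (Fin m)) : ℝ :=
  p.coeff (∑ i ∈ S, Finsupp.single i 1)

/-- `p_B`, the sum of the coefficients `p_S` over `S ∈ B`. -/
def familyCoeff {m : ℕ} (B : Finset (Finset (Fin m))) (p : MvPolynomial (Fin m) ℝ) : ℝ :=
  ∑ S ∈ B, setCoeff p S

/-- The dual family `B⋆ = {[m] ∖ S : S ∈ B}`. -/
def dualFamily {m : ℕ} (B : Finset (Finset (Fin m))) : Finset (Finset (Fin m)) :=
  B.image (fun S => Sᶜ)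

/-- `P(B)`, the convex hull of the characteristic vectors of the members of `B`. -/
def polytope {m : ℕ} (B : Finset (Finset (Fin m))) : Set (Fin m → ℝ) :=
  convexHull ℝ ((fun S : Finset (Fin m) => fun i : Fin m => if i ∈ S then (1 : ℝ) else 0) ''
    (B : Set (Finset (Fin m))))

/-- `inf_{z > 0} p(z) / ∏ i, z i ^ θ i`. For `p` with nonnegative coefficients this is an infimum
of nonnegative numbers over a nonempty set, and it is at most `p(1, …, 1)`. -/
def capAt {m : ℕ} (p : MvPolynomial (Fin m) ℝ) (θ : Fin m → ℝ) : ℝ :=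
  ⨅ z : {z : Fin m → ℝ // ∀ i, 0 < z i}, MvPolynomial.eval z.1 p / ∏ i, (z.1 i) ^ (θ i)

/-- The `B`-capacity. For `p` with nonnegative coefficients the supremum is over numbers in
`[0, p(1, …, 1)]`; for the empty family the value is `0`, the supremum of `∅` in `[0, ∞]`. -/
def cap {m : ℕ} (B : Finset (Finset (Fin m))) (p : MvPolynomial (Fin m) ℝ) : ℝ :=
  ⨆ θ : polytope B, capAt p θ.1

/-- The lower `B`-capacity. For `p` with nonnegative coefficients and `B` nonempty this is an
infimum of nonnegative numbers over a nonempty set. -/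
def lowerCap {m : ℕ} (B : Finset (Finset (Fin m))) (p : MvPolynomial (Fin m) ℝ) : ℝ :=
  ⨅ θ : polytope B, capAt p θ.1

/-- `h` is a `B`-selection, where `B` is a family of `k`-element sets. -/
structure IsSelection {m : ℕ} (k : ℕ) (B : Finset (Finset (Fin m)))
    (h : MvPolynomial (Fin m) ℝ) : Prop where
  nonneg : NonnegCoeffs h
  homogeneous : h.IsHomogeneous k
  mem_of_pos : ∀ S : Finset (Fin m), S.card = k → 0 < setCoeff h S → S ∈ B
  eq_one : ∀ S ∈ B, setCoeff h S = 1

/-- `h` is a `c`-approximate `B`-selection, where `B` is a family of `k`-element sets. -/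
structure IsApproxSelection {m : ℕ} (c : ℝ) (k : ℕ) (B : Finset (Finset (Fin m)))
    (h : MvPolynomial (Fin m) ℝ) : Prop where
  nonneg : NonnegCoeffs h
  homogeneous : h.IsHomogeneous k
  mem_of_pos : ∀ S : Finset (Fin m), S.card = k → 0 < setCoeff h S → S ∈ B
  mem_Icc : ∀ S ∈ B, setCoeff h S ∈ Set.Icc 1 c

end

end SetCapacity

/-! The upper bound is weighted AM-GM: take the average of the vectors `1_S` with weights `g_S /
g_B` as `θ`, and compare `∏ z_i ^ θ_i` with the square-free part of `g` (`familyCoeff_le_cap`).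

For the lower bounds, consider the coefficient of `z_1 ⋯ z_m` in `g * h`. It equals `∑ g_S h_{Sᶜ}`,
and since `h` is supported, among sets of size `m - n`, on the dual family with values at most `c`,
it is at most `c * g_B` (`coeff_one_mul_le`). On the other hand `g * h` is real stable and
`m`-homogeneous, and since `θ ∈ P(B)` gives `1 - θ ∈ P(B⋆)`, the product of the two capacities
bounds `g * h` below by a multiple of `∏ z_i`. Gurvits' inequality
(`IsRealStable.mul_prod_le_coeff_one`) turns this into a lower bound on the coefficient.

Gurvits' inequality removes one variable at a time by taking the coefficient of its first power.
Each removal costs a factor `(d / (d + 1)) ^ d`, by AM-GM on the roots of a univariate real-rooted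
polynomial (`mul_pow_le_coeff_one`). The new polynomial must again be stable
(`coeff_one_finSuccEquiv`); this is proved by locating roots, using that a homogeneous polynomial
may have its argument rotated by any complex scalar. -/

namespace SetCapacity

/-! ### Univariate polynomials with real roots -/

open Polynomial in
theorem eval_eq_eval_zero_mul_prod_roots {R : ℂ[X]} (h0 : R.eval 0 ≠ 0) (t : ℂ) :
    R.eval t = R.eval 0 * (R.roots.map fun r => 1 - t / r).prod := by
  have hs := IsAlgClosed.splits R
  rw [hs.eval_eq_prod_roots t, hs.eval_eq_prod_roots 0, mul_assoc, ← Multiset.prod_map_mul]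
  congr 2
  refine Multiset.map_congr rfl fun r hr => ?_
  have hr0 : r ≠ 0 := by
    rintro rfl
    exact h0 ((mem_roots'.1 hr).2)
  field_simp
  ring

open Polynomial in
theorem coeff_one_eq_eval_zero_mul_sum_roots {R : ℂ[X]} (h0 : R.eval 0 ≠ 0) :
    R.coeff 1 = R.eval 0 * (R.roots.map fun r => -(1 / r)).sum := by
  have h := (IsAlgClosed.splits R).eval_derivative_div_eval_of_ne_zero h0
  rw [div_eq_iff h0, mul_comm] at h
  have h1 : R.derivative.eval 0 = R.coeff 1 := by
    rw [← coeff_zero_eq_eval_zero, coeff_derivative]; simp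
  rw [← h1, h]
  congr 2
  refine Multiset.map_congr rfl fun r _ => ?_
  simp [div_neg]

theorem multiset_prod_norm (s : Multiset ℂ) : ‖s.prod‖ = (s.map fun z => ‖z‖).prod := by
  induction s using Multiset.induction with
  | empty => simp
  | cons a s ih => simp [ih]

-- Each factor `1 + i / r` with `r` real has real part `1`, hence modulus at least `1`.
open Polynomial in
theorem norm_eval_zero_le_norm_eval_neg_I {R : ℂ[X]} (hroots : ∀ r : ℂ, R.eval r = 0 → r.im = 0) :
    ‖R.eval 0‖ ≤ ‖R.eval (-Complex.I)‖ := by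
  by_cases h0 : R.eval 0 = 0
  · simp [h0]
  rw [eval_eq_eval_zero_mul_prod_roots h0 (-Complex.I), norm_mul]
  refine le_mul_of_one_le_right (norm_nonneg _) ?_
  rw [multiset_prod_norm, Multiset.map_map]
  have hr : ∀ r ∈ R.roots, r.im = 0 := fun r hr => hroots r (mem_roots'.1 hr).2
  generalize R.roots = s at hr
  induction s using Multiset.induction with
  | empty => simp
  | cons a s ih =>
    rw [Multiset.map_cons, Multiset.prod_cons]
    refine one_le_mul_of_one_le_of_one_le ?_ (ih fun r hr' => hr r (Multiset.mem_cons_of_mem hr'))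
    have ha := hr a (Multiset.mem_cons_self a s)
    have : (1 - -Complex.I / a).re = 1 := by
      simp [Complex.div_re, ha]
    calc (1 : ℝ) = |(1 - -Complex.I / a).re| := by rw [this]; simp
      _ ≤ _ := Complex.abs_re_le_norm _

theorem le_mul_exp_div_sub_one {μ : ℝ} (hμ : 0 < μ) (x : ℝ) : x ≤ μ * Real.exp (x / μ - 1) := by
  have h := Real.add_one_le_exp (x / μ - 1)
  have h2 : x = μ * (x / μ - 1 + 1) := by field_simp; ring
  calc x = μ * (x / μ - 1 + 1) := h2
    _ ≤ _ := by gcongr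

/-- AM-GM for the factors `1 + a` padded by ones to `N` factors of mean `μ`: multiply the tangent
bounds `x ≤ μ * exp (x / μ - 1)`; the exponents add up to zero. -/
theorem multiset_prod_one_add_le {s : Multiset ℝ} (hs : ∀ a ∈ s, 0 ≤ a) {N : ℕ} (hN : 0 < N)
    (hcard : s.card ≤ N) : (s.map fun a => 1 + a).prod ≤ (1 + s.sum / N) ^ N := by
  set μ : ℝ := 1 + s.sum / N with hμdef
  have hN' : (0 : ℝ) < N := by exact_mod_cast hN
  have hμ : 0 < μ := by
    have : 0 ≤ s.sum := Multiset.sum_nonneg hs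
    positivity
  have key : ∀ u : Multiset ℝ, (∀ a ∈ u, 0 ≤ a) →
      (u.map fun a => 1 + a).prod ≤ μ ^ u.card * Real.exp ((u.card + u.sum) / μ - u.card) ∧
      0 ≤ (u.map fun a => 1 + a).prod := by
    intro u
    induction u using Multiset.induction with
    | empty => intro _; simp
    | cons a u ih =>
      intro hu
      obtain ⟨h1, h2⟩ := ih fun b hb => hu b (Multiset.mem_cons_of_mem hb)
      have ha := hu a (Multiset.mem_cons_self a u)
      simp only [Multiset.map_cons, Multiset.prod_cons, Multiset.card_cons, Multiset.sum_cons]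
      refine ⟨?_, by positivity⟩
      calc (1 + a) * (u.map fun a => 1 + a).prod
          ≤ (μ * Real.exp ((1 + a) / μ - 1)) *
            (μ ^ u.card * Real.exp ((u.card + u.sum) / μ - u.card)) := by
            gcongr
            exact le_mul_exp_div_sub_one hμ _
        _ = _ := by
            rw [mul_mul_mul_comm, ← Real.exp_add, pow_succ' μ]
            congr 2
            push_cast
            ring
  obtain ⟨h1, -⟩ := key s hs
  obtain ⟨k, hk⟩ := Nat.exists_eq_add_of_le hcard
  -- The `k` padding factors, each equal to `1`.
  have h3 : 1 ≤ (μ * Real.exp (1 / μ - 1)) ^ k := one_le_pow₀ (le_mul_exp_div_sub_one hμ 1)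
  calc (s.map fun a => 1 + a).prod
      ≤ μ ^ s.card * Real.exp ((s.card + s.sum) / μ - s.card) := h1
    _ ≤ μ ^ s.card * Real.exp ((s.card + s.sum) / μ - s.card) *
        (μ * Real.exp (1 / μ - 1)) ^ k := le_mul_of_one_le_right (by positivity) h3
    _ = μ ^ N * Real.exp ((N + s.sum) / μ - N) := by
        rw [mul_pow, ← Real.exp_nat_mul, mul_mul_mul_comm, ← Real.exp_add, ← pow_add, ← hk]
        congr 2
        rw [hk]
        push_cast
        ring
    _ = μ ^ N := by
        have : (N + s.sum) / μ - N = 0 := by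
          have h4 : (N : ℝ) + s.sum = N * μ := by rw [hμdef]; field_simp
          rw [h4, mul_div_cancel_right₀ _ hμ.ne', sub_self]
        rw [this, Real.exp_zero, mul_one]

theorem mul_pow_le_of_forall_mul_le {C a s : ℝ} {d : ℕ} (ha : 0 < a) (hs : 0 ≤ s)
    (h : ∀ t : ℝ, 0 < t → C * t ≤ a * (1 + t * s / (d + 1 : ℕ)) ^ (d + 1)) :
    C * ((d : ℝ) / (d + 1 : ℕ)) ^ d ≤ a * s := by
  rcases Nat.eq_zero_or_pos d with rfl | hd
  · by_contra! hc
    simp only [pow_zero, mul_one] at hc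
    have h1 : 0 < C - a * s := by linarith
    -- For `d = 0` the hypothesis reads `(C - a * s) * t ≤ a`, which this `t` violates.
    have h2 := h ((a + 1) / (C - a * s)) (by positivity)
    simp only [zero_add, Nat.cast_one, div_one, pow_one] at h2
    have h3 : (C - a * s) * ((a + 1) / (C - a * s)) = a + 1 := by field_simp
    nlinarith
  have hd' : (0 : ℝ) < d := by exact_mod_cast hd
  rcases hs.eq_or_lt with rfl | hs
  · have hC : C ≤ 0 := by
      by_contra! hc
      have h2 := h ((a + 1) / C) (by positivity)
      have h3 : C * ((a + 1) / C) = a + 1 := by field_simp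
      simp only [mul_zero, zero_div, add_zero, one_pow, mul_one] at h2
      linarith
    rw [mul_zero]
    exact mul_nonpos_of_nonpos_of_nonneg hC (by positivity)
  -- This `t` minimises `(1 + t * s / (d + 1)) ^ (d + 1) / t`.
  have h2 := h ((d + 1 : ℕ) / (s * d)) (by positivity)
  have h3 : 1 + ((d + 1 : ℕ) : ℝ) / (s * d) * s / (d + 1 : ℕ) = (d + 1 : ℕ) / d := by
    push_cast
    field_simp
  rw [h3] at h2
  have h4 : ((d : ℝ) / (d + 1 : ℕ)) ^ d * (((d + 1 : ℕ) : ℝ) / d) ^ (d + 1) = (d + 1 : ℕ) / d := by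
    rw [pow_succ, ← mul_assoc, ← mul_pow]
    have : (d : ℝ) / (d + 1 : ℕ) * (((d + 1 : ℕ) : ℝ) / d) = 1 := by
      push_cast; field_simp
    rw [this, one_pow, one_mul]
  have h5 : C * (((d + 1 : ℕ) : ℝ) / (s * d)) * ((d : ℝ) / (d + 1 : ℕ)) ^ d ≤
      a * (((d + 1 : ℕ) : ℝ) / d) := by
    calc _ ≤ a * (((d + 1 : ℕ) : ℝ) / d) ^ (d + 1) * ((d : ℝ) / (d + 1 : ℕ)) ^ d := by gcongr
      _ = _ := by rw [mul_assoc, mul_comm (_ ^ (d + 1)), h4]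
  have h6 : (0 : ℝ) < (d + 1 : ℕ) / (s * d) := by positivity
  refine le_of_mul_le_mul_right ?_ h6
  calc _ = C * (((d + 1 : ℕ) : ℝ) / (s * d)) * ((d : ℝ) / (d + 1 : ℕ)) ^ d := by ring
    _ ≤ _ := h5
    _ = _ := by field_simp

open Polynomial in
/-- The univariate capacity inequality: a real-rooted polynomial `R` of degree at most `d + 1` with
nonnegative coefficients satisfies `(d / (d + 1)) ^ d * inf_{t > 0} R t / t ≤ R' 0`. -/
theorem mul_pow_le_coeff_one {R : ℝ[X]} {d : ℕ} (hdeg : R.natDegree ≤ d + 1)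
    (hnn : ∀ k, 0 ≤ R.coeff k)
    (hroots : ∀ t : ℂ, aeval t R = 0 → t.im = 0 ∧ t.re ≤ 0) {C : ℝ} (hC : 0 ≤ C)
    (h : ∀ t : ℝ, 0 < t → C * t ≤ R.eval t) :
    C * ((d : ℝ) / (d + 1 : ℕ)) ^ d ≤ R.coeff 1 := by
  -- If `R 0 = 0`, dividing by `t` and letting `t → 0` gives even `C ≤ R' 0`. Otherwise `R t = R 0 *
  -- ∏ (1 + t * a)` and `R' 0 = R 0 * ∑ a` with `a = -1 / r ≥ 0` over the roots `r`, and AM-GM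
  -- bounds the product through the sum.
  by_cases h0 : R.coeff 0 = 0
  · have hR : R = R.divX * X := by
      conv_lhs => rw [← divX_mul_X_add R, h0, C_0, add_zero]
    have hle : ∀ t : ℝ, 0 < t → C ≤ R.divX.eval t := by
      intro t ht
      have := h t ht
      rw [hR, eval_mul, eval_X] at this
      exact le_of_mul_le_mul_right this ht
    have hlim : Filter.Tendsto (fun t => R.divX.eval t) (nhdsWithin 0 (Set.Ioi 0))
        (nhds (R.divX.eval 0)) := (R.divX.continuous.tendsto 0).mono_left nhdsWithin_le_nhds
    have hC1 : C ≤ R.divX.eval 0 :=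
      ge_of_tendsto hlim (by filter_upwards [self_mem_nhdsWithin] with t ht using hle t ht)
    rw [← coeff_zero_eq_eval_zero, coeff_divX] at hC1
    refine le_trans (mul_le_of_le_one_right hC (pow_le_one₀ (by positivity) ?_)) hC1
    rw [div_le_one (by positivity)]
    push_cast
    linarith
  have ha : 0 < R.coeff 0 := lt_of_le_of_ne (hnn 0) (Ne.symm h0)
  set Q : ℂ[X] := R.map (algebraMap ℝ ℂ) with hQ
  have hev : ∀ t : ℝ, Q.eval (t : ℂ) = (R.eval t : ℝ) := by
    intro t
    rw [hQ, eval_map_algebraMap]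
    exact aeval_algebraMap_apply_eq_algebraMap_eval t R
  have hQ0 : Q.eval 0 = (R.coeff 0 : ℝ) := by
    rw [← coeff_zero_eq_eval_zero, hQ, coeff_map]; rfl
  have hQ0' : Q.eval 0 ≠ 0 := by rw [hQ0]; exact_mod_cast h0
  have hr : ∀ r ∈ Q.roots, r.im = 0 ∧ r.re ≤ 0 := by
    intro r hr
    refine hroots r ?_
    rw [← eval_map_algebraMap]
    exact (mem_roots'.1 hr).2
  have hcard : Q.roots.card ≤ d + 1 :=
    (card_roots' Q).trans (natDegree_map_le.trans hdeg)
  set A : Multiset ℝ := Q.roots.map fun r => -(1 / r.re) with hA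
  have hA0 : ∀ a ∈ A, 0 ≤ a := by
    intro a ha'
    obtain ⟨r, hr', rfl⟩ := Multiset.mem_map.1 ha'
    have := (hr r hr').2
    rw [neg_nonneg]
    exact div_nonpos_of_nonneg_of_nonpos zero_le_one this
  have hsum : R.coeff 1 = R.coeff 0 * A.sum := by
    have h1 := coeff_one_eq_eval_zero_mul_sum_roots hQ0'
    rw [hQ0] at h1
    have h2 : (Q.roots.map fun r => -(1 / r)).sum = ((A.sum : ℝ) : ℂ) := by
      rw [hA, ← Complex.ofRealHom_eq_coe, map_multiset_sum, Multiset.map_map]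
      congr 1
      refine Multiset.map_congr rfl fun r hr' => ?_
      have : r = (r.re : ℂ) := Complex.ext (by simp) (by simp [(hr r hr').1])
      conv_lhs => rw [this]
      simp
    rw [h2, hQ, coeff_map, Complex.coe_algebraMap] at h1
    exact_mod_cast h1
  have hprod : ∀ t : ℝ, R.eval t = R.coeff 0 * (A.map fun a => 1 + t * a).prod := by
    intro t
    have h1 := eval_eq_eval_zero_mul_prod_roots hQ0' t
    rw [hQ0, hev] at h1
    have h2 : (Q.roots.map fun r => 1 - (t : ℂ) / r).prod =
        (((A.map fun a => 1 + t * a).prod : ℝ) : ℂ) := by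
      rw [hA, ← Complex.ofRealHom_eq_coe (Multiset.prod _), map_multiset_prod, Multiset.map_map, Multiset.map_map]
      congr 1
      refine Multiset.map_congr rfl fun r hr' => ?_
      have : r = (r.re : ℂ) := Complex.ext (by simp) (by simp [(hr r hr').1])
      conv_lhs => rw [this]
      simp [div_eq_mul_inv, sub_eq_add_neg]
    rw [h2] at h1
    exact_mod_cast h1
  rw [hsum]
  refine mul_pow_le_of_forall_mul_le ha (Multiset.sum_nonneg hA0) fun t ht => ?_
  refine (h t ht).trans ?_
  rw [hprod]
  gcongr
  have := multiset_prod_one_add_le (s := A.map fun a => t * a) (N := d + 1) (by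
    intro a ha'
    obtain ⟨b, hb, rfl⟩ := Multiset.mem_map.1 ha'
    exact mul_nonneg ht.le (hA0 b hb)) (Nat.succ_pos d) (by simpa [hA] using hcard)
  rw [Multiset.map_map, Multiset.sum_map_mul_left, Multiset.map_id'] at this
  exact this

/-! ### Homogeneous real stable polynomials and their slices -/

open MvPolynomial

theorem aeval_smul_of_isHomogeneous {m d : ℕ} {p : MvPolynomial (Fin m) ℝ}
    (hp : p.IsHomogeneous d) (w : ℂ) (z : Fin m → ℂ) :
    aeval (fun i => w * z i) p = w ^ d * aeval z p := by
  rw [aeval_def, aeval_def, eval₂_eq', eval₂_eq', Finset.mul_sum]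
  refine Finset.sum_congr rfl fun α hα => ?_
  have h : ∑ i, α i = d := by
    rw [hp.degree_eq_sum_deg_support hα]
    exact (Finset.sum_subset (Finset.subset_univ _) fun i _ hi => by simpa using hi).symm
  simp only [mul_pow]
  rw [Finset.prod_mul_distrib, Finset.prod_pow_eq_pow_sum, h]
  ring

theorem IsRealStable.aeval_ne_zero_of_mul {m d : ℕ} {p : MvPolynomial (Fin m) ℝ}
    (hs : IsRealStable p) (hp : p.IsHomogeneous d) {z : Fin m → ℂ} (w : ℂ)
    (hw : ∀ i, 0 < (w * z i).im) : aeval z p ≠ 0 := by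
  intro h
  refine hs (fun i => w * z i) hw ?_
  rw [aeval_smul_of_isHomogeneous hp, h, mul_zero]

theorem aeval_ofReal {m : ℕ} (p : MvPolynomial (Fin m) ℝ) (x : Fin m → ℝ) :
    aeval (fun i => (x i : ℂ)) p = ((eval x p : ℝ) : ℂ) := by
  have := aeval_algebraMap_apply (A := ℝ) ℂ x p
  simpa [Function.comp_def, aeval_eq_eval] using this

theorem NonnegCoeffs.eval_nonneg {m : ℕ} {p : MvPolynomial (Fin m) ℝ} (hp : NonnegCoeffs p)
    {x : Fin m → ℝ} (hx : ∀ i, 0 ≤ x i) : 0 ≤ eval x p := by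
  rw [eval_eq']
  exact Finset.sum_nonneg fun α _ =>
    mul_nonneg (hp α) (Finset.prod_nonneg fun i _ => pow_nonneg (hx i) _)

theorem NonnegCoeffs.eval_pos {m : ℕ} {p : MvPolynomial (Fin m) ℝ} (hp : NonnegCoeffs p)
    (hp0 : p ≠ 0) {x : Fin m → ℝ} (hx : ∀ i, 0 < x i) : 0 < eval x p := by
  rw [eval_eq']
  refine Finset.sum_pos (fun α hα => ?_) (support_nonempty.2 hp0)
  exact mul_pos (lt_of_le_of_ne (hp α) (Ne.symm (mem_support_iff.1 hα)))
    (Finset.prod_pos fun i _ => pow_pos (hx i) _)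

theorem IsRealStable.ne_zero {m : ℕ} {p : MvPolynomial (Fin m) ℝ} (hs : IsRealStable p) :
    p ≠ 0 := by
  rintro rfl
  exact hs (fun _ => Complex.I) (by simp) (by simp)

/-- The restriction of a homogeneous real stable polynomial to a line with positive direction is
real-rooted; hence its modulus at `x + iy` is at least its value at `y`. -/
theorem IsRealStable.eval_im_le_norm {m d : ℕ} {p : MvPolynomial (Fin m) ℝ}
    (hs : IsRealStable p) (hp : p.IsHomogeneous d) (hnn : NonnegCoeffs p) {z : Fin m → ℂ}
    (hz : ∀ i, 0 < (z i).im) : eval (fun i => (z i).im) p ≤ ‖aeval z p‖ := by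
  let R : Polynomial ℂ :=
    aeval (fun i => Polynomial.C ((z i).re : ℂ) * Polynomial.X + Polynomial.C ((z i).im : ℂ)) p
  have hR : ∀ s : ℂ, R.eval s = aeval (fun i => (z i).re * s + (z i).im) p := by
    intro s
    have h := comp_aeval_apply (R := ℝ)
      (fun i => Polynomial.C ((z i).re : ℂ) * Polynomial.X + Polynomial.C ((z i).im : ℂ))
      ((Polynomial.aeval (R := ℂ) s).restrictScalars ℝ) p
    simpa [Polynomial.coe_aeval_eq_eval] using h
  have hpos := hnn.eval_pos hs.ne_zero hz
  have hR0 : R.eval 0 = ((eval (fun i => (z i).im) p : ℝ) : ℂ) := by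
    rw [hR, ← aeval_ofReal]; simp
  have hroots : ∀ r : ℂ, R.eval r = 0 → r.im = 0 := by
    intro r hr
    by_contra hne
    rw [hR] at hr
    rcases lt_or_gt_of_ne hne with h | h
    -- Multiplying `x * r + y` by `conj r` makes the `x` term real, so only `y * conj r` contributes
    -- to the imaginary part.
    · refine hs.aeval_ne_zero_of_mul hp ((starRingEnd ℂ) r) (fun i => ?_) hr
      have : ((starRingEnd ℂ) r * ((z i).re * r + (z i).im)).im = -r.im * (z i).im := by
        simp; ring
      rw [this]
      exact mul_pos (neg_pos.2 h) (hz i)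
    · refine hs.aeval_ne_zero_of_mul hp (-(starRingEnd ℂ) r) (fun i => ?_) hr
      have : (-(starRingEnd ℂ) r * ((z i).re * r + (z i).im)).im = r.im * (z i).im := by
        simp; ring
      rw [this]
      exact mul_pos h (hz i)
  have h1 := norm_eval_zero_le_norm_eval_neg_I hroots
  -- `x + i y = i (-i x + y)`, and homogeneity pulls out the scalar `i`.
  have h2 : aeval z p = Complex.I ^ d * R.eval (-Complex.I) := by
    rw [hR, ← aeval_smul_of_isHomogeneous hp]
    congr 2
    funext i
    apply Complex.ext <;> simp
  rw [h2, norm_mul, norm_pow, Complex.norm_I, one_pow, one_mul]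
  rw [hR0, Complex.norm_real, Real.norm_of_nonneg hpos.le] at h1
  exact h1

/-- The univariate polynomial obtained by fixing all variables but the first. -/
noncomputable def sliceAt {m : ℕ} {S : Type*} [CommRing S] [Algebra ℝ S]
    (p : MvPolynomial (Fin (m + 1)) ℝ) (z : Fin m → S) : Polynomial S :=
  (finSuccEquiv ℝ m p).map (aeval z : MvPolynomial (Fin m) ℝ →ₐ[ℝ] S).toRingHom

theorem eval_sliceAt {m : ℕ} {S : Type*} [CommRing S] [Algebra ℝ S]
    (p : MvPolynomial (Fin (m + 1)) ℝ) (z : Fin m → S) (t : S) :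
    (sliceAt p z).eval t = aeval (Fin.cons t z : Fin (m + 1) → S) p := by
  induction p using MvPolynomial.induction_on with
  | C a => simp [sliceAt, finSuccEquiv_apply]
  | add p q hp hq =>
    have : sliceAt (p + q) z = sliceAt p z + sliceAt q z := by simp [sliceAt]
    rw [this, Polynomial.eval_add, hp, hq, map_add]
  | mul_X p i hp =>
    have : sliceAt (p * X i) z = sliceAt p z * sliceAt (X i) z := by simp [sliceAt]
    rw [this, Polynomial.eval_mul, hp, map_mul, aeval_X]
    congr 1
    refine Fin.cases ?_ (fun j => ?_) i
    · simp [sliceAt, finSuccEquiv_X_zero]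
    · simp [sliceAt, finSuccEquiv_X_succ]

theorem coeff_sliceAt {m : ℕ} {S : Type*} [CommRing S] [Algebra ℝ S]
    (p : MvPolynomial (Fin (m + 1)) ℝ) (z : Fin m → S) (k : ℕ) :
    (sliceAt p z).coeff k = aeval z ((finSuccEquiv ℝ m p).coeff k) := by
  simp [sliceAt, Polynomial.coeff_map]

theorem NonnegCoeffs.coeff_finSuccEquiv {m : ℕ} {p : MvPolynomial (Fin (m + 1)) ℝ}
    (hp : NonnegCoeffs p) (k : ℕ) : NonnegCoeffs ((finSuccEquiv ℝ m p).coeff k) := by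
  intro α
  rw [finSuccEquiv_coeff_coeff]
  exact hp _

theorem mul_coeff_one_le_eval {R : Polynomial ℝ} (hR : ∀ k, 0 ≤ R.coeff k) {t : ℝ} (ht : 0 ≤ t) :
    t * R.coeff 1 ≤ R.eval t := by
  by_cases h : 1 ∈ R.support
  · rw [Polynomial.eval_eq_sum, Polynomial.sum]
    calc t * R.coeff 1 = R.coeff 1 * t ^ 1 := by ring
      _ ≤ _ := Finset.single_le_sum (f := fun k => R.coeff k * t ^ k)
        (fun k _ => mul_nonneg (hR k) (pow_nonneg ht k)) h
  · rw [Polynomial.notMem_support_iff.1 h, mul_zero, Polynomial.eval_eq_sum, Polynomial.sum]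
    exact Finset.sum_nonneg fun k _ => mul_nonneg (hR k) (pow_nonneg ht k)

theorem exists_pos_forall_add_mul_pos {m : ℕ} {y : Fin m → ℝ} (hy : ∀ i, 0 < y i) (x : Fin m → ℝ) :
    ∃ δ : ℝ, 0 < δ ∧ ∀ i, 0 < y i + δ * x i := by
  have h : ∀ᶠ δ : ℝ in nhdsWithin 0 (Set.Ioi 0), ∀ i, 0 < y i + δ * x i := by
    rw [Filter.eventually_all]
    intro i
    have hc : Continuous fun δ : ℝ => y i + δ * x i := by fun_prop
    have := hc.continuousAt (x := 0) |>.eventually (lt_mem_nhds (by simpa using hy i))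
    exact nhdsWithin_le_nhds this
  obtain ⟨δ, h1, h2⟩ := (h.and self_mem_nhdsWithin).exists
  exact ⟨δ, h2, h1⟩

/-- For fixed `z` in the open upper half-plane, the roots of `t ↦ p (t, z)` other than `0` lie in
the open lower half-plane. -/
theorem IsRealStable.im_neg_of_eval_sliceAt {m d : ℕ} {p : MvPolynomial (Fin (m + 1)) ℝ}
    (hs : IsRealStable p) (hp : p.IsHomogeneous d) {z : Fin m → ℂ} (hz : ∀ i, 0 < (z i).im)
    {r : ℂ} (hr0 : r ≠ 0) (hr : (sliceAt p z).eval r = 0) : r.im < 0 := by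
  rw [eval_sliceAt] at hr
  by_contra! h
  rcases h.lt_or_eq with h | h
  · refine hs _ (fun i => ?_) hr
    refine Fin.cases ?_ (fun j => ?_) i
    · simpa using h
    · simpa using hz j
  -- A nonzero real root `r` is excluded by the slight rotation `1 + i δ r`: it gives `r` the
  -- imaginary part `δ r²` and, for small `δ`, keeps every `z i` in the upper half-plane.
  · obtain ⟨δ, hδ, hδ'⟩ := exists_pos_forall_add_mul_pos hz fun i => r.re * (z i).re
    have hre : r.re ≠ 0 := fun h' => hr0 (Complex.ext h' h.symm)
    refine hs.aeval_ne_zero_of_mul hp (1 + (δ * r.re : ℝ) * Complex.I) (fun i => ?_) hr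
    refine Fin.cases ?_ (fun j => ?_) i
    · have : 0 < δ * (r.re * r.re) := mul_pos hδ (mul_self_pos.2 hre)
      simp [← h]
      linarith
    · have := hδ' j
      simp
      linarith

/-- With `R t = p (t, z)`, the claim is `R' 0 ≠ 0`. If `R 0 = 0`, the linear lower bound on `‖R (i
T)‖` survives division by `T` as `T → 0`. If `R 0 ≠ 0`, then `R' 0 / R 0 = -∑ 1 / r`, where all
roots lie in the open lower half-plane, so every term has negative imaginary part. -/
theorem IsRealStable.coeff_one_finSuccEquiv {m d : ℕ} {p : MvPolynomial (Fin (m + 1)) ℝ}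
    (hs : IsRealStable p) (hp : p.IsHomogeneous d) (hnn : NonnegCoeffs p)
    (hq : (finSuccEquiv ℝ m p).coeff 1 ≠ 0) : IsRealStable ((finSuccEquiv ℝ m p).coeff 1) := by
  intro z hz
  set q := (finSuccEquiv ℝ m p).coeff 1 with hqdef
  have hqpos : 0 < eval (fun i => (z i).im) q := (hnn.coeff_finSuccEquiv 1).eval_pos hq hz
  set R := sliceAt p z with hR
  rw [hqdef, ← coeff_sliceAt, ← hR]
  have hlow : ∀ T : ℝ, 0 < T → T * eval (fun i => (z i).im) q ≤ ‖R.eval (T * Complex.I)‖ := by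
    intro T hT
    have h1 := hs.eval_im_le_norm hp hnn (z := Fin.cons (T * Complex.I) z) (fun i => by
      refine Fin.cases ?_ (fun j => ?_) i
      · simpa using hT
      · simpa using hz j)
    rw [← eval_sliceAt] at h1
    refine le_trans ?_ h1
    have h2 : (fun i => ((Fin.cons (T * Complex.I) z : Fin (m + 1) → ℂ) i).im) =
        Fin.cons T (fun i => (z i).im) := by
      funext i
      refine Fin.cases ?_ (fun j => ?_) i <;> simp
    have h3 := mul_coeff_one_le_eval (R := sliceAt p fun i => (z i).im) (fun k => by
      rw [coeff_sliceAt, aeval_eq_eval]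
      exact (hnn.coeff_finSuccEquiv k).eval_nonneg fun i => (hz i).le) hT.le
    rw [h2]
    rw [coeff_sliceAt, eval_sliceAt, aeval_eq_eval, aeval_eq_eval] at h3
    exact h3
  by_cases h0 : R.eval 0 = 0
  · intro h1
    have hR0 : R.coeff 0 = 0 := by rw [Polynomial.coeff_zero_eq_eval_zero, h0]
    have hRX : R = R.divX * Polynomial.X := by
      conv_lhs => rw [← Polynomial.divX_mul_X_add R, hR0, Polynomial.C_0, add_zero]
    have hle : ∀ T : ℝ, 0 < T →
        eval (fun i => (z i).im) q ≤ ‖R.divX.eval (T * Complex.I)‖ := by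
      intro T hT
      have := hlow T hT
      rw [hRX, Polynomial.eval_mul, Polynomial.eval_X, norm_mul, norm_mul, Complex.norm_I, mul_one,
        Complex.norm_real, Real.norm_of_nonneg hT.le, mul_comm] at this
      exact le_of_mul_le_mul_right this hT
    have hc : Continuous fun T : ℝ => ‖R.divX.eval (T * Complex.I)‖ := by fun_prop
    have hlim := (hc.tendsto 0).mono_left (nhdsWithin_le_nhds (s := Set.Ioi 0))
    have := ge_of_tendsto hlim (by filter_upwards [self_mem_nhdsWithin] with T hT using hle T hT)
    rw [Complex.ofReal_zero, zero_mul, ← Polynomial.coeff_zero_eq_eval_zero, Polynomial.coeff_divX,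
      zero_add, h1, norm_zero] at this
    exact absurd hqpos this.not_gt
  · have hneg : ∀ r ∈ R.roots, r.im < 0 := by
      intro r hr
      have hr' : R.eval r = 0 := (Polynomial.mem_roots'.1 hr).2
      refine hs.im_neg_of_eval_sliceAt hp hz ?_ hr'
      rintro rfl
      exact h0 hr'
    -- Without roots `R` would be constant, against the linear growth in `hlow`.
    have hne : R.roots ≠ 0 := by
      intro hroots
      have hconst := eval_eq_eval_zero_mul_prod_roots h0
      rw [hroots] at hconst
      simp only [Multiset.map_zero, Multiset.prod_zero, mul_one] at hconst
      have h1 := hlow ((‖R.eval 0‖ + 1) / eval (fun i => (z i).im) q) (by positivity)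
      rw [hconst (_ * _), div_mul_cancel₀ _ hqpos.ne'] at h1
      linarith
    rw [coeff_one_eq_eval_zero_mul_sum_roots h0]
    refine mul_ne_zero h0 fun hsum => ?_
    have key : ∀ s : Multiset ℂ, (∀ r ∈ s, r.im < 0) →
        (s.map fun r => -(1 / r)).sum.im ≤ 0 ∧
          (s ≠ 0 → (s.map fun r => -(1 / r)).sum.im < 0) := by
      intro s
      induction s using Multiset.induction with
      | empty => simp
      | cons a s ih =>
        intro hs'
        have h1 := (ih fun r hr => hs' r (Multiset.mem_cons_of_mem hr)).1
        have ha := hs' a (Multiset.mem_cons_self a s)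
        have h2 : (-(1 / a)).im < 0 := by
          have ha0 : 0 < Complex.normSq a := Complex.normSq_pos.2 (by rintro rfl; simp at ha)
          have : (-(1 / a)).im = a.im / Complex.normSq a := by
            simp [Complex.inv_im, neg_div]
          rw [this]
          exact div_neg_of_neg_of_pos ha ha0
        have h3 : ((a ::ₘ s).map fun r => -(1 / r)).sum.im < 0 := by
          rw [Multiset.map_cons, Multiset.sum_cons, Complex.add_im]
          linarith
        exact ⟨h3.le, fun _ => h3⟩
    have := (key R.roots hneg).2 hne
    rw [hsum] at this
    simp at this

theorem IsRealStable.nonpos_of_eval_sliceAt {m d : ℕ} {p : MvPolynomial (Fin (m + 1)) ℝ}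
    (hs : IsRealStable p) (hp : p.IsHomogeneous d) {x : Fin m → ℝ} (hx : ∀ i, 0 < x i) {t : ℂ}
    (ht : Polynomial.aeval t (sliceAt p x) = 0) : t.im = 0 ∧ t.re ≤ 0 := by
  have h1 : Polynomial.aeval t (sliceAt p x) =
      aeval (Fin.cons t (fun i => (x i : ℂ)) : Fin (m + 1) → ℂ) p := by
    rw [← eval_sliceAt, ← Polynomial.eval_map_algebraMap]
    congr 1
    ext1 k
    rw [Polynomial.coeff_map, coeff_sliceAt, coeff_sliceAt, aeval_ofReal, aeval_eq_eval]
    rfl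
  rw [h1] at ht
  have him : t.im = 0 := by
    by_contra hne
    -- The scalar has imaginary part `1`, so `x j` acquires imaginary part `x j`; its real part is
    -- chosen so that `t` acquires imaginary part `1`.
    refine hs.aeval_ne_zero_of_mul hp (((1 - t.re) / t.im : ℝ) + Complex.I) (fun i => ?_) ht
    refine Fin.cases ?_ (fun j => ?_) i
    · simp only [Fin.cons_zero, Complex.mul_im, Complex.add_re, Complex.ofReal_re, Complex.I_re,
        Complex.add_im, Complex.ofReal_im, Complex.I_im]
      rw [add_zero, div_mul_cancel₀ _ hne]
      linarith
    · simpa using hx j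
  refine ⟨him, ?_⟩
  by_contra! hre
  refine hs.aeval_ne_zero_of_mul hp Complex.I (fun i => ?_) ht
  refine Fin.cases ?_ (fun j => ?_) i
  · simpa using hre
  · simpa using hx j

/-! ### Gurvits' capacity inequality and its constants -/

theorem apply_le_of_mem_support {m d : ℕ} {p : MvPolynomial (Fin m) ℝ} (hp : p.IsHomogeneous d)
    {α : Fin m →₀ ℕ} (hα : α ∈ p.support) (i : Fin m) : α i ≤ d := by
  rw [hp.degree_eq_sum_deg_support hα]
  by_cases h : i ∈ α.support
  · exact Finset.single_le_sum (f := fun i => α i) (fun _ _ => Nat.zero_le _) h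
  · rw [Finsupp.notMem_support_iff.1 h]
    exact Nat.zero_le _

/-- Gurvits' capacity inequality for a homogeneous real stable polynomial of degree `m` in `m`
variables, all of whose degrees in the single variables are at most `K`. -/
theorem IsRealStable.mul_prod_le_coeff_one (K : ℕ) {m : ℕ} (p : MvPolynomial (Fin m) ℝ)
    (hs : IsRealStable p) (hp : p.IsHomogeneous m) (hnn : NonnegCoeffs p)
    (hK : ∀ α ∈ p.support, ∀ i, α i ≤ K + 1) {C : ℝ} (hC : 0 ≤ C)
    (h : ∀ x : Fin m → ℝ, (∀ i, 0 < x i) → C * ∏ i, x i ≤ eval x p) :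
    C * ∏ k ∈ Finset.range m, (((min k K : ℕ) : ℝ) / (min k K + 1 : ℕ)) ^ (min k K) ≤
      p.coeff (Finsupp.equivFunOnFinite.symm fun _ => 1) := by
  induction m generalizing C with
  | zero =>
    have h1 := h (fun _ => 1) (by simp)
    have h2 : p = MvPolynomial.C (p.coeff 0) := eq_C_of_isEmpty p
    have h3 : (Finsupp.equivFunOnFinite.symm fun _ => 1 : Fin 0 →₀ ℕ) = 0 := Subsingleton.elim _ _
    rw [h2, eval_C] at h1
    rw [h3]
    simpa using h1
  | succ m ih =>
    have h3 : (Finsupp.equivFunOnFinite.symm fun _ => 1 : Fin (m + 1) →₀ ℕ) =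
        Finsupp.cons 1 (Finsupp.equivFunOnFinite.symm fun _ => 1 : Fin m →₀ ℕ) := by
      ext i
      refine Fin.cases ?_ (fun j => ?_) i <;> simp
    rw [h3, ← finSuccEquiv_coeff_coeff, Finset.prod_range_succ, mul_comm (Finset.prod _ _),
      ← mul_assoc]
    set q := (finSuccEquiv ℝ m p).coeff 1 with hq
    have hqnn : NonnegCoeffs q := hnn.coeff_finSuccEquiv 1
    have hcap : ∀ x : Fin m → ℝ, (∀ i, 0 < x i) →
        C * (((min m K : ℕ) : ℝ) / (min m K + 1 : ℕ)) ^ (min m K) * ∏ i, x i ≤ eval x q := by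
      intro x hx
      -- The total degree gives the bound `m + 1`, the hypothesis `hK` gives `K + 1`.
      have hdeg : (sliceAt p x).natDegree ≤ min m K + 1 := by
        rw [Polynomial.natDegree_le_iff_coeff_eq_zero]
        intro N hN
        rw [coeff_sliceAt]
        suffices (finSuccEquiv ℝ m p).coeff N = 0 by rw [this, map_zero]
        ext α
        rw [finSuccEquiv_coeff_coeff, coeff_zero]
        by_contra hne
        have hmem : Finsupp.cons N α ∈ p.support := mem_support_iff.2 hne
        have h4 := hK _ hmem 0
        rw [Finsupp.cons_zero] at h4
        have h6 := apply_le_of_mem_support hp hmem 0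
        rw [Finsupp.cons_zero] at h6
        omega
      have hpx : 0 < ∏ i, x i := Finset.prod_pos fun i _ => hx i
      have h4 := mul_pow_le_coeff_one (C := C * ∏ i, x i) hdeg (fun k => by
          rw [coeff_sliceAt, aeval_eq_eval]
          exact (hnn.coeff_finSuccEquiv k).eval_nonneg fun i => (hx i).le)
        (fun t ht => hs.nonpos_of_eval_sliceAt hp hx ht) (by positivity) (fun t ht => by
          rw [eval_sliceAt, aeval_eq_eval]
          have h5 := h (Fin.cons t x) (fun i => by
            refine Fin.cases ?_ (fun j => ?_) i
            · simpa using ht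
            · simpa using hx j)
          rw [Fin.prod_univ_succ] at h5
          simp only [Fin.cons_zero, Fin.cons_succ] at h5
          calc C * (∏ i, x i) * t = C * (t * ∏ i, x i) := by ring
            _ ≤ _ := h5)
      rw [coeff_sliceAt, aeval_eq_eval] at h4
      calc _ = C * (∏ i, x i) * (((min m K : ℕ) : ℝ) / (min m K + 1 : ℕ)) ^ (min m K) := by ring
        _ ≤ _ := h4
    -- The zero polynomial is not stable, so induction does not apply; but then `hcap` forces the
    -- constant to be nonpositive.
    by_cases hq0 : q = 0
    · have h4 := hcap (fun _ => 1) (by simp)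
      rw [hq0] at h4 ⊢
      simp only [Finset.prod_const_one, mul_one, map_zero, coeff_zero] at h4 ⊢
      exact mul_nonpos_of_nonpos_of_nonneg h4 (by positivity)
    · refine ih q (hs.coeff_one_finSuccEquiv hp hnn hq0)
        (hp.finSuccEquiv_coeff_isHomogeneous 1 m (add_comm 1 m)) hqnn ?_ (by positivity) hcap
      intro α hα i
      rw [mem_support_iff, finSuccEquiv_coeff_coeff] at hα
      have := hK _ (mem_support_iff.2 hα) i.succ
      rwa [Finsupp.cons_succ] at this

/-- The product telescopes: `m! / m ^ m * (m / (m + 1)) ^ m = (m + 1)! / (m + 1) ^ (m + 1)`. -/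
theorem prod_range_min_self (m : ℕ) :
    ∏ k ∈ Finset.range m, (((min k m : ℕ) : ℝ) / (min k m + 1 : ℕ)) ^ (min k m) =
      (m.factorial : ℝ) / (m : ℝ) ^ m := by
  have h : ∀ k ∈ Finset.range m, (((min k m : ℕ) : ℝ) / (min k m + 1 : ℕ)) ^ (min k m) =
      ((k : ℝ) / (k + 1 : ℕ)) ^ k := by
    intro k hk
    rw [min_eq_left (Finset.mem_range.1 hk).le]
  rw [Finset.prod_congr rfl h]
  clear h
  induction m with
  | zero => simp
  | succ m ih =>
    rw [Finset.prod_range_succ, ih, Nat.factorial_succ]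
    rcases Nat.eq_zero_or_pos m with rfl | hm
    · simp
    have hm' : (m : ℝ) ≠ 0 := by exact_mod_cast hm.ne'
    push_cast
    rw [div_pow]
    field_simp
    ring

theorem one_div_two_pow_le_prod_range_min_one (m : ℕ) :
    1 / (2 : ℝ) ^ m ≤
      ∏ k ∈ Finset.range m, (((min k 1 : ℕ) : ℝ) / (min k 1 + 1 : ℕ)) ^ (min k 1) := by
  rw [← one_div_pow]
  calc (1 / 2 : ℝ) ^ m = ∏ k ∈ Finset.range m, (1 / 2 : ℝ) := by simp
    _ ≤ _ := by
      refine Finset.prod_le_prod (fun _ _ => by norm_num) fun k _ => ?_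
      rcases Nat.eq_zero_or_pos k with rfl | hk
      · norm_num
      · rw [min_eq_right (show 1 ≤ k from hk)]
        norm_num

/-! ### Square-free coefficients and the upper bound by the capacity -/

theorem sum_single_one_apply {m : ℕ} (S : Finset (Fin m)) (i : Fin m) :
    (∑ j ∈ S, Finsupp.single j 1 : Fin m →₀ ℕ) i = if i ∈ S then 1 else 0 := by
  simp [Finsupp.finsetSum_apply, Finsupp.single_apply]

theorem sum_single_one_injective {m : ℕ} :
    Function.Injective fun S : Finset (Fin m) => (∑ j ∈ S, Finsupp.single j 1 : Fin m →₀ ℕ) := by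
  intro S T h
  ext i
  have := DFunLike.congr_fun h i
  simp only [sum_single_one_apply] at this
  split_ifs at this <;> simp_all

theorem NonnegCoeffs.setCoeff_nonneg {m : ℕ} {p : MvPolynomial (Fin m) ℝ} (hp : NonnegCoeffs p)
    (S : Finset (Fin m)) : 0 ≤ setCoeff p S := hp _

theorem NonnegCoeffs.familyCoeff_nonneg {m : ℕ} {p : MvPolynomial (Fin m) ℝ} (hp : NonnegCoeffs p)
    (B : Finset (Finset (Fin m))) : 0 ≤ familyCoeff B p :=
  Finset.sum_nonneg fun S _ => hp.setCoeff_nonneg S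

theorem NonnegCoeffs.sum_setCoeff_mul_le_eval {m : ℕ} {p : MvPolynomial (Fin m) ℝ}
    (hp : NonnegCoeffs p) (B : Finset (Finset (Fin m))) {z : Fin m → ℝ} (hz : ∀ i, 0 < z i) :
    ∑ S ∈ B, setCoeff p S * ∏ i ∈ S, z i ≤ eval z p := by
  classical
  let e : Finset (Fin m) → (Fin m →₀ ℕ) := fun S => ∑ j ∈ S, Finsupp.single j 1
  have h1 : ∑ S ∈ B, setCoeff p S * ∏ i ∈ S, z i =
      ∑ α ∈ B.image e, p.coeff α * ∏ i, z i ^ α i := by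
    rw [Finset.sum_image fun S _ T _ h => sum_single_one_injective h]
    refine Finset.sum_congr rfl fun S _ => ?_
    simp only [sum_single_one_apply, pow_ite, pow_one, pow_zero, Finset.prod_ite_mem,
      Finset.univ_inter]
    rfl
  have h2 : eval z p = ∑ α ∈ p.support ∪ B.image e, p.coeff α * ∏ i, z i ^ α i := by
    rw [eval_eq']
    refine Finset.sum_subset Finset.subset_union_left fun α _ hα => ?_
    rw [notMem_support_iff.1 hα, zero_mul]
  rw [h1, h2]
  exact Finset.sum_le_sum_of_subset_of_nonneg Finset.subset_union_right fun α _ _ =>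
    mul_nonneg (hp α) (Finset.prod_nonneg fun i _ => pow_nonneg (hz i).le _)

theorem prod_rpow_pos {m : ℕ} {z : Fin m → ℝ} (hz : ∀ i, 0 < z i) (θ : Fin m → ℝ) :
    0 < ∏ i, z i ^ θ i := Finset.prod_pos fun i _ => Real.rpow_pos_of_pos (hz i) _

theorem NonnegCoeffs.capAt_nonneg {m : ℕ} {p : MvPolynomial (Fin m) ℝ} (hp : NonnegCoeffs p)
    (θ : Fin m → ℝ) : 0 ≤ capAt p θ :=
  Real.iInf_nonneg fun z => div_nonneg (hp.eval_nonneg fun i => (z.2 i).le) (prod_rpow_pos z.2 θ).le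

theorem NonnegCoeffs.capAt_le {m : ℕ} {p : MvPolynomial (Fin m) ℝ} (hp : NonnegCoeffs p)
    (θ : Fin m → ℝ) {z : Fin m → ℝ} (hz : ∀ i, 0 < z i) :
    capAt p θ ≤ eval z p / ∏ i, z i ^ θ i :=
  ciInf_le (f := fun z : {z : Fin m → ℝ // ∀ i, 0 < z i} => eval z.1 p / ∏ i, (z.1 i) ^ (θ i))
    ⟨0, by
      rintro _ ⟨z, rfl⟩
      exact div_nonneg (hp.eval_nonneg fun i => (z.2 i).le) (prod_rpow_pos z.2 θ).le⟩ ⟨z, hz⟩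

theorem NonnegCoeffs.capAt_le_cap {m : ℕ} {p : MvPolynomial (Fin m) ℝ} (hp : NonnegCoeffs p)
    {B : Finset (Finset (Fin m))} {θ : Fin m → ℝ} (hθ : θ ∈ polytope B) : capAt p θ ≤ cap B p :=
  le_ciSup (f := fun θ : polytope B => capAt p θ.1)
    ⟨eval (fun _ => 1) p, by
      rintro _ ⟨θ, rfl⟩
      simpa using hp.capAt_le θ.1 (z := fun _ => 1) (by simp)⟩ ⟨θ, hθ⟩

theorem NonnegCoeffs.lowerCap_le_capAt {m : ℕ} {p : MvPolynomial (Fin m) ℝ} (hp : NonnegCoeffs p)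
    {B : Finset (Finset (Fin m))} {θ : Fin m → ℝ} (hθ : θ ∈ polytope B) :
    lowerCap B p ≤ capAt p θ :=
  ciInf_le (f := fun θ : polytope B => capAt p θ.1)
    ⟨0, by
      rintro _ ⟨θ, rfl⟩
      exact hp.capAt_nonneg θ.1⟩ ⟨θ, hθ⟩

theorem NonnegCoeffs.lowerCap_nonneg {m : ℕ} {p : MvPolynomial (Fin m) ℝ} (hp : NonnegCoeffs p)
    (B : Finset (Finset (Fin m))) : 0 ≤ lowerCap B p :=
  Real.iInf_nonneg fun θ => hp.capAt_nonneg θ.1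

theorem NonnegCoeffs.familyCoeff_le_cap {m : ℕ} {p : MvPolynomial (Fin m) ℝ}
    (hp : NonnegCoeffs p) (B : Finset (Finset (Fin m))) : familyCoeff B p ≤ cap B p := by
  rcases (hp.familyCoeff_nonneg B).eq_or_lt with h | h
  · rw [← h]
    -- This also covers the empty family, whose real supremum is `0`.
    exact Real.iSup_nonneg fun θ => hp.capAt_nonneg θ.1
  set w : Finset (Fin m) → ℝ := fun S => setCoeff p S / familyCoeff B p with hw
  have hw0 : ∀ S ∈ B, 0 ≤ w S := fun S _ => div_nonneg (hp.setCoeff_nonneg S) h.le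
  have hw1 : ∑ S ∈ B, w S = 1 := by
    rw [hw, ← Finset.sum_div]
    exact div_self h.ne'
  set θ : Fin m → ℝ := ∑ S ∈ B, w S • fun i => if i ∈ S then (1 : ℝ) else 0 with hθ
  have hmem : θ ∈ polytope B :=
    (convex_convexHull ℝ _).sum_mem hw0 hw1 fun S hS => subset_convexHull ℝ _ ⟨S, hS, rfl⟩
  refine le_trans ?_ (hp.capAt_le_cap hmem)
  have : Nonempty {z : Fin m → ℝ // ∀ i, 0 < z i} := ⟨⟨fun _ => 1, by simp⟩⟩
  refine le_ciInf fun ⟨z, hz⟩ => ?_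
  rw [le_div_iff₀ (prod_rpow_pos hz θ)]
  have hprod : ∏ i, z i ^ θ i = ∏ S ∈ B, (∏ i ∈ S, z i) ^ w S := by
    calc ∏ i, z i ^ θ i = ∏ i, ∏ S ∈ B, z i ^ (w S * if i ∈ S then (1 : ℝ) else 0) := by
          refine Finset.prod_congr rfl fun i _ => ?_
          rw [← Real.rpow_sum_of_pos (hz i)]
          congr 1
          simp [hθ, Finset.sum_apply]
      _ = ∏ S ∈ B, ∏ i, z i ^ (w S * if i ∈ S then (1 : ℝ) else 0) := Finset.prod_comm
      _ = _ := by
          refine Finset.prod_congr rfl fun S _ => ?_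
          rw [← Real.finsetProd_rpow _ _ fun i _ => (hz i).le]
          simp only [mul_ite, mul_one, mul_zero]
          rw [← Finset.prod_subset (Finset.subset_univ S)]
          · exact Finset.prod_congr rfl fun i hi => by rw [if_pos hi]
          · intro i _ hi
            rw [if_neg hi, Real.rpow_zero]
  rw [hprod]
  have hamgm := Real.geom_mean_le_arith_mean_weighted B w (fun S => ∏ i ∈ S, z i) hw0 hw1
    fun S _ => Finset.prod_nonneg fun i _ => (hz i).le
  calc familyCoeff B p * ∏ S ∈ B, (∏ i ∈ S, z i) ^ w S
      ≤ familyCoeff B p * ∑ S ∈ B, w S * ∏ i ∈ S, z i := by gcongr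
    _ = ∑ S ∈ B, setCoeff p S * ∏ i ∈ S, z i := by
        rw [Finset.mul_sum]
        refine Finset.sum_congr rfl fun S _ => ?_
        rw [hw, ← mul_assoc, mul_div_cancel₀ _ h.ne']
    _ ≤ _ := hp.sum_setCoeff_mul_le_eval B hz

/-! ### Duality and the lower bounds -/

theorem one_sub_mem_polytope_dualFamily {m : ℕ} {B : Finset (Finset (Fin m))} {θ : Fin m → ℝ}
    (hθ : θ ∈ polytope B) : 1 - θ ∈ polytope (dualFamily B) := by
  let f : (Fin m → ℝ) →ᵃ[ℝ] (Fin m → ℝ) :=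
    AffineMap.const ℝ _ 1 - AffineMap.id ℝ _
  have hf : ∀ x, f x = 1 - x := fun x => by simp [f]
  have h : polytope B ⊆ f ⁻¹' polytope (dualFamily B) := by
    refine convexHull_min ?_ ((convex_convexHull ℝ _).affine_preimage f)
    rintro _ ⟨S, hS, rfl⟩
    refine subset_convexHull ℝ _ ⟨Sᶜ, ?_, ?_⟩
    · exact Finset.mem_coe.2 (Finset.mem_image_of_mem _ hS)
    · rw [hf]
      funext i
      by_cases hi : i ∈ S <;> simp [hi]
  have := h hθ
  rwa [Set.mem_preimage, hf] at this

/-- Exponent vectors adding up to the all-ones vector are indicators of complementary sets. -/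
theorem coeff_one_mul {m : ℕ} (g h : MvPolynomial (Fin m) ℝ) :
    (g * h).coeff (Finsupp.equivFunOnFinite.symm fun _ => 1) =
      ∑ S : Finset (Fin m), setCoeff g S * setCoeff h Sᶜ := by
  classical
  rw [coeff_mul]
  refine Finset.sum_nbij' (fun a => a.1.support)
    (fun S => (∑ j ∈ S, Finsupp.single j 1, ∑ j ∈ Sᶜ, Finsupp.single j 1)) ?_ ?_ ?_ ?_ ?_
  · simp
  · intro S _
    rw [Finset.HasAntidiagonal.mem_antidiagonal]
    ext i
    rw [Finsupp.add_apply, sum_single_one_apply, sum_single_one_apply]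
    by_cases hi : i ∈ S <;> simp [hi]
  · rintro ⟨a, b⟩ hab
    rw [Finset.HasAntidiagonal.mem_antidiagonal] at hab
    have hab' : ∀ i, a i + b i = 1 := fun i => by simpa using DFunLike.congr_fun hab i
    refine Prod.ext ?_ ?_ <;> ext i <;> rw [sum_single_one_apply] <;> have := hab' i
    · by_cases hi : a i = 0 <;> simp [hi]; omega
    · by_cases hi : a i = 0 <;> simp [hi] <;> omega
  · intro S _
    ext i
    simp [sum_single_one_apply]
  · rintro ⟨a, b⟩ hab
    rw [Finset.HasAntidiagonal.mem_antidiagonal] at hab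
    have hab' : ∀ i, a i + b i = 1 := fun i => by simpa using DFunLike.congr_fun hab i
    have ha : (∑ j ∈ a.support, Finsupp.single j 1 : Fin m →₀ ℕ) = a := by
      ext i
      have := hab' i
      rw [sum_single_one_apply]
      by_cases hi : a i = 0 <;> simp [hi]; omega
    have hb : (∑ j ∈ a.supportᶜ, Finsupp.single j 1 : Fin m →₀ ℕ) = b := by
      ext i
      have := hab' i
      rw [sum_single_one_apply]
      by_cases hi : a i = 0 <;> simp [hi] <;> omega
    simp only [setCoeff, ha, hb]

theorem IsApproxSelection.coeff_one_mul_le {m n : ℕ} {c : ℝ} {B : Finset (Finset (Fin m))}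
    {g h : MvPolynomial (Fin m) ℝ} (hg : NonnegCoeffs g) (hghom : g.IsHomogeneous n)
    (hh : IsApproxSelection c (m - n) (dualFamily B) h) :
    (g * h).coeff (Finsupp.equivFunOnFinite.symm fun _ => 1) ≤ c * familyCoeff B g := by
  classical
  rw [coeff_one_mul, familyCoeff, Finset.mul_sum,
    ← Finset.sum_subset (Finset.subset_univ B)]
  · refine Finset.sum_le_sum fun S hS => ?_
    rw [mul_comm]
    exact mul_le_mul_of_nonneg_right (hh.mem_Icc _ (Finset.mem_image_of_mem _ hS)).2
      (hg.setCoeff_nonneg S)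
  -- A nonzero term outside `B` is impossible: `g_S ≠ 0` forces `|S| = n`, and then `h_{Sᶜ} > 0`
  -- forces `Sᶜ` into the dual family.
  · intro S _ hS
    by_contra hne
    have hgS : setCoeff g S ≠ 0 := left_ne_zero_of_mul hne
    have hhS : setCoeff h Sᶜ ≠ 0 := right_ne_zero_of_mul hne
    have hcard : S.card = n := by
      have h1 : (∑ j ∈ S, Finsupp.single j 1 : Fin m →₀ ℕ).degree = n := by
        by_contra h2
        exact hgS (hghom.coeff_eq_zero h2)
      rw [map_sum] at h1
      simpa using h1
    have hpos : 0 < setCoeff h Sᶜ := lt_of_le_of_ne (hh.nonneg.setCoeff_nonneg _) hhS.symm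
    have h3 := hh.mem_of_pos Sᶜ (by rw [Finset.card_compl, Fintype.card_fin, hcard]) hpos
    obtain ⟨T, hT, hTS⟩ := Finset.mem_image.1 h3
    rw [compl_inj_iff] at hTS
    exact hS (hTS ▸ hT)

theorem NonnegCoeffs.mul {m : ℕ} {g h : MvPolynomial (Fin m) ℝ} (hg : NonnegCoeffs g)
    (hh : NonnegCoeffs h) : NonnegCoeffs (g * h) := by
  classical
  intro α
  rw [coeff_mul]
  exact Finset.sum_nonneg fun a _ => mul_nonneg (hg _) (hh _)

theorem IsRealStable.mul {m : ℕ} {g h : MvPolynomial (Fin m) ℝ} (hg : IsRealStable g)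
    (hh : IsRealStable h) : IsRealStable (g * h) := by
  intro z hz
  rw [map_mul]
  exact mul_ne_zero (hg z hz) (hh z hz)

theorem IsApproxSelection.capAt_mul_lowerCap_mul_le {m n : ℕ} {c : ℝ}
    {B : Finset (Finset (Fin m))} (hn : n ≤ m) {g h : MvPolynomial (Fin m) ℝ}
    (hg : NonnegCoeffs g) (hgs : IsRealStable g) (hghom : g.IsHomogeneous n)
    (hh : IsApproxSelection c (m - n) (dualFamily B) h) (hhs : IsRealStable h) (K : ℕ)
    (hK : ∀ α ∈ (g * h).support, ∀ i, α i ≤ K + 1) {θ : Fin m → ℝ} (hθ : θ ∈ polytope B) :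
    capAt g θ * lowerCap (dualFamily B) h *
      ∏ k ∈ Finset.range m, (((min k K : ℕ) : ℝ) / (min k K + 1 : ℕ)) ^ (min k K) ≤
      c * familyCoeff B g := by
  have hhom : (g * h).IsHomogeneous m := by
    have := hghom.mul hh.homogeneous
    rwa [Nat.add_sub_cancel' hn] at this
  refine le_trans ?_ (hh.coeff_one_mul_le hg hghom)
  refine (hgs.mul hhs).mul_prod_le_coeff_one K _ hhom (hg.mul hh.nonneg) hK
    (mul_nonneg (hg.capAt_nonneg θ) (hh.nonneg.lowerCap_nonneg _)) fun z hz => ?_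
  have h1 := (le_div_iff₀ (prod_rpow_pos hz θ)).1 (hg.capAt_le θ hz)
  have h2 := (le_div_iff₀ (prod_rpow_pos hz (1 - θ))).1
    ((hh.nonneg.lowerCap_le_capAt (one_sub_mem_polytope_dualFamily hθ)).trans
      (hh.nonneg.capAt_le (1 - θ) hz))
  have h3 : (∏ i, z i ^ θ i) * ∏ i, z i ^ (1 - θ) i = ∏ i, z i := by
    rw [← Finset.prod_mul_distrib]
    refine Finset.prod_congr rfl fun i _ => ?_
    rw [← Real.rpow_add (hz i)]
    simp
  rw [← h3, map_mul, mul_mul_mul_comm]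
  exact mul_le_mul h1 h2
    (mul_nonneg (hh.nonneg.lowerCap_nonneg _) (prod_rpow_pos hz _).le)
    (hg.eval_nonneg fun i => (hz i).le)

theorem cap_mul_le {m : ℕ} {B : Finset (Finset (Fin m))} {g : MvPolynomial (Fin m) ℝ} {a b : ℝ}
    (ha : 0 ≤ a) (hb : 0 ≤ b) (h : ∀ θ ∈ polytope B, capAt g θ * a ≤ b) : cap B g * a ≤ b := by
  rw [cap, Real.iSup_mul_of_nonneg ha]
  exact Real.iSup_le (fun θ => h θ.1 θ.2) hb

theorem IsApproxSelection.cap_mul_lowerCap_mul_le {m n : ℕ} {c : ℝ} (hc : 0 ≤ c)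
    {B : Finset (Finset (Fin m))} (hB : ∀ S ∈ B, S.card = n) {g h : MvPolynomial (Fin m) ℝ}
    (hg : NonnegCoeffs g) (hgs : IsRealStable g) (hghom : g.IsHomogeneous n)
    (hh : IsApproxSelection c (m - n) (dualFamily B) h) (hhs : IsRealStable h) (K : ℕ)
    (hK : n ≤ m → ∀ α ∈ (g * h).support, ∀ i, α i ≤ K + 1) :
    cap B g * lowerCap (dualFamily B) h *
      ∏ k ∈ Finset.range m, (((min k K : ℕ) : ℝ) / (min k K + 1 : ℕ)) ^ (min k K) ≤
      c * familyCoeff B g := by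
  rw [mul_assoc]
  refine cap_mul_le (mul_nonneg (hh.nonneg.lowerCap_nonneg _)
    (Finset.prod_nonneg fun k _ => by positivity))
    (mul_nonneg hc (hg.familyCoeff_nonneg B)) fun θ hθ => ?_
  rw [← mul_assoc]
  -- Needed because `m - n` is truncated. A point of the polytope supplies an `n`-subset of `[m]`;
  -- for empty `B` the capacity is `0`, so no `θ` has to be treated.
  have hn : n ≤ m := by
    obtain ⟨_, S, hS, -⟩ := convexHull_nonempty_iff.1 ⟨θ, hθ⟩
    rw [← hB S hS]
    simpa using S.card_le_univ
  exact hh.capAt_mul_lowerCap_mul_le hn hg hgs hghom hhs K (hK hn) hθ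

theorem IsMultiaffine.apply_le_two_of_mem_support_mul {m : ℕ} {g h : MvPolynomial (Fin m) ℝ}
    (hg : IsMultiaffine g) (hh : IsMultiaffine h) :
    ∀ α ∈ (g * h).support, ∀ i, α i ≤ 1 + 1 := by
  classical
  intro α hα i
  obtain ⟨a, ha, b, hb, rfl⟩ := Finset.mem_add.1 (support_mul g h hα)
  exact add_le_add (hg a ha i) (hh b hb i)

theorem IsApproxSelection.cap_mul_lowerCap_le {m n : ℕ} {c : ℝ} (hc : 1 ≤ c)
    {B : Finset (Finset (Fin m))} (hB : ∀ S ∈ B, S.card = n) {g h : MvPolynomial (Fin m) ℝ}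
    (hg : NonnegCoeffs g) (hgs : IsRealStable g) (hghom : g.IsHomogeneous n)
    (hh : IsApproxSelection c (m - n) (dualFamily B) h) (hhs : IsRealStable h) :
    cap B g * lowerCap (dualFamily B) h * ((m.factorial : ℝ) / (m : ℝ) ^ m) / c ≤
        familyCoeff B g ∧
      (IsMultiaffine g → IsMultiaffine h →
        cap B g * lowerCap (dualFamily B) h * (1 / (2 : ℝ) ^ m) / c ≤ familyCoeff B g) := by
  have hc0 : 0 < c := zero_lt_one.trans_le hc
  refine ⟨?_, fun hgm hhm => ?_⟩ <;> rw [div_le_iff₀' hc0]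
  -- With `K = m` the condition on single-variable degrees follows from the total degree `m`; the
  -- multiaffine case takes `K = 1`, since a product of two multiaffine polynomials has degree at
  -- most `2` in each variable.
  · rw [← prod_range_min_self]
    refine hh.cap_mul_lowerCap_mul_le hc0.le hB hg hgs hghom hhs m fun hn α hα i => ?_
    have := apply_le_of_mem_support (hghom.mul hh.homogeneous) hα i
    omega
  · refine le_trans ?_ (hh.cap_mul_lowerCap_mul_le hc0.le hB hg hgs hghom hhs 1
      fun _ => hgm.apply_le_two_of_mem_support_mul hhm)
    refine mul_le_mul_of_nonneg_left (one_div_two_pow_le_prod_range_min_one m)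
      (mul_nonneg (Real.iSup_nonneg fun θ => hg.capAt_nonneg θ.1) (hh.nonneg.lowerCap_nonneg _))

theorem IsSelection.isApproxSelection {m k : ℕ} {B : Finset (Finset (Fin m))}
    {h : MvPolynomial (Fin m) ℝ} (hh : IsSelection k B h) : IsApproxSelection 1 k B h where
  nonneg := hh.nonneg
  homogeneous := hh.homogeneous
  mem_of_pos := hh.mem_of_pos
  mem_Icc S hS := by simp [hh.eq_one S hS]

end SetCapacity

theorem lemma3p3 (m n : ℕ) (B : Finset (Finset (Fin m))) (hB : ∀ S ∈ B, S.card = n)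
    (g : MvPolynomial (Fin m) ℝ) (hg_nonneg : SetCapacity.NonnegCoeffs g)
    (hg_stable : SetCapacity.IsRealStable g) (hg_hom : g.IsHomogeneous n) :
    SetCapacity.familyCoeff B g ≤ SetCapacity.cap B g ∧
    (∀ h : MvPolynomial (Fin m) ℝ,
      SetCapacity.IsSelection (m - n) (SetCapacity.dualFamily B) h →
      SetCapacity.IsRealStable h →
        SetCapacity.cap B g * SetCapacity.lowerCap (SetCapacity.dualFamily B) h
            * ((m.factorial : ℝ) / (m : ℝ) ^ m) ≤ SetCapacity.familyCoeff B g ∧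
        (SetCapacity.IsMultiaffine g → SetCapacity.IsMultiaffine h →
          SetCapacity.cap B g * SetCapacity.lowerCap (SetCapacity.dualFamily B) h
            * (1 / (2 : ℝ) ^ m) ≤ SetCapacity.familyCoeff B g)) ∧
    (∀ c : ℝ, 1 ≤ c → ∀ h : MvPolynomial (Fin m) ℝ,
      SetCapacity.IsApproxSelection c (m - n) (SetCapacity.dualFamily B) h →
      SetCapacity.IsRealStable h →
        SetCapacity.cap B g * SetCapacity.lowerCap (SetCapacity.dualFamily B) h
            * ((m.factorial : ℝ) / (m : ℝ) ^ m) / c ≤ SetCapacity.familyCoeff B g ∧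
        (SetCapacity.IsMultiaffine g → SetCapacity.IsMultiaffine h →
          SetCapacity.cap B g * SetCapacity.lowerCap (SetCapacity.dualFamily B) h
            * (1 / (2 : ℝ) ^ m) / c ≤ SetCapacity.familyCoeff B g)) := by
  refine ⟨hg_nonneg.familyCoeff_le_cap B, fun h hh hhs => ?_, fun c hc h hh hhs =>
    hh.cap_mul_lowerCap_le hc hB hg_nonneg hg_stable hg_hom hhs⟩
  simpa only [div_one] using
    hh.isApproxSelection.cap_mul_lowerCap_le le_rfl hB hg_nonneg hg_stable hg_hom hhs
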